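/- For an open set $\Omega\subset\mathbb C^n$, let $K_\Omega$ denote its Bergman kernel function, i.e. the unique function on $\Omega\times\Omega$ such that, for every $z\in\Omega$, the function $w\mapsto\overline{K_\Omega(z,w)}$ is holomorphic and square-integrable (with respect to Lebesgue measure $dV$) on $\Omega$, and $f(z)=\int_\Omega f(w)\,K_\Omega(z,w)\,dV(w)$ for every square-integrable holomorphic function $f$ on $\Omega$. Let $$D=\{z\in\mathbb C^3: |z_1|+|z_2|+|z_3|<1\},\qquad \Omega_4=\{z\in\mathbb C^2: |z_1|+|z_2|^{2/4}<1\}.$$ Then $D$ and $\Omega_4$ are open, $D$ is convex, both Bergman kernels exist, and: (a) $K_D$ has zeroes: there are $z,w\in D$ with $K_D(z,w)=0$. (b) For all $z_1,w_1\in\mathbb C$ with $|z_1|<1$, $|w_1|<1$, $$K_D\big((z_1,0,0),(w_1,0,0)\big)=\frac{6}{\pi}\,K_{\Omega_4}\big((z_1,0),(w_1,0)\big).$$ (c) For all $z_1,w_1\in\mathbb C$ with $|z_1|<1$, $|w_1|<1$, writing $x=z_1\overline{w_1}$, $$K_{\Omega_4}\big((z_1^2,0),(w_1^2,0)\big)=0\quad\Longleftrightarrow\quad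 x\neq0\ \text{ and }\ \Big(\frac{1+x}{1-x}\Big)^{6}=1,$$ and the equation $\big(\frac{1+x}{1-x}\big)^6=1$ does have a solution $x\ne0$ with $|x|<1$. -/

import Mathlib

open MeasureTheory
open scoped ComplexConjugate

/-- `f` belongs to the Bergman space of `Ω ⊆ ℂⁿ`: it is holomorphic on `Ω` and
square-integrable on `Ω` with respect to Lebesgue measure. -/
def MemBergmanSpace {n : ℕ} (Ω : Set (Fin n → ℂ)) (f : (Fin n → ℂ) → ℂ) : Prop :=
  DifferentiableOn ℂ f Ω ∧ MemLp f 2 (volume.restrict Ω)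

/-- `K` is the reproducing kernel of the Bergman space of `Ω`: for each `z ∈ Ω` the function
`w ↦ conj (K z w)` is in the Bergman space, and `f z = ∫_Ω f w * K z w dV(w)` for each `f` in the
Bergman space. The values of `K` outside `Ω × Ω` are irrelevant. -/
def IsBergmanKernel {n : ℕ} (Ω : Set (Fin n → ℂ)) (K : (Fin n → ℂ) → (Fin n → ℂ) → ℂ) : Prop :=
  ∀ z ∈ Ω, MemBergmanSpace Ω (fun w => conj (K z w)) ∧
    ∀ f, MemBergmanSpace Ω f → f z = ∫ w in Ω, f w * K z w

/-- On an open set, the reproducing kernel of the Bergman space is unique. -/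
theorem IsBergmanKernel.unique {n : ℕ} {Ω : Set (Fin n → ℂ)} (hΩ : IsOpen Ω)
    {K L : (Fin n → ℂ) → (Fin n → ℂ) → ℂ} (hK : IsBergmanKernel Ω K) (hL : IsBergmanKernel Ω L)
    {z w : Fin n → ℂ} (hz : z ∈ Ω) (hw : w ∈ Ω) : K z w = L z w := by
  obtain ⟨hK1, hK2⟩ := hK z hz
  obtain ⟨hL1, hL2⟩ := hL z hz
  set g : (Fin n → ℂ) → ℂ := fun w => conj (K z w) - conj (L z w) with hg
  have hgB : MemBergmanSpace Ω g := ⟨hK1.1.sub hL1.1, hK1.2.sub hL1.2⟩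
  have hKm : MemLp (fun w => K z w) 2 (volume.restrict Ω) := by
    have h := hK1.2.star
    have e : star (fun w => conj (K z w)) = fun w => K z w := by
      ext w
      simp
    rwa [e] at h
  have hLm : MemLp (fun w => L z w) 2 (volume.restrict Ω) := by
    have h := hL1.2.star
    have e : star (fun w => conj (L z w)) = fun w => L z w := by
      ext w
      simp
    rwa [e] at h
  have hiK : Integrable (fun w => g w * K z w) (volume.restrict Ω) := hgB.2.integrable_mul hKm
  have hiL : Integrable (fun w => g w * L z w) (volume.restrict Ω) := hgB.2.integrable_mul hLm
  have h0 : ∫ w in Ω, (g w * K z w - g w * L z w) = 0 := by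
    rw [integral_sub hiK hiL, ← hK2 g hgB, ← hL2 g hgB, sub_self]
  have hpt : ∀ w, g w * K z w - g w * L z w = ((‖g w‖ ^ 2 : ℝ) : ℂ) := by
    intro w
    have hc : conj (g w) = K z w - L z w := by simp [hg]
    rw [← mul_sub, ← hc, Complex.mul_conj, Complex.normSq_eq_norm_sq]
  simp only [hpt] at h0
  have h1 : ∫ w in Ω, ‖g w‖ ^ 2 = 0 := by
    rw [integral_complex_ofReal] at h0
    exact_mod_cast h0
  rw [integral_eq_zero_iff_of_nonneg (fun _ => by positivity)
    ((memLp_two_iff_integrable_sq_norm hgB.2.1).1 hgB.2)] at h1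
  have h2 : g =ᵐ[volume.restrict Ω] (fun _ => (0 : ℂ)) := by
    filter_upwards [h1] with w hw
    simpa using hw
  have h3 := Measure.eqOn_open_of_ae_eq h2 hΩ hgB.1.continuousOn continuousOn_const
  have h4 : conj (K z w) - conj (L z w) = 0 := h3 hw
  exact (starRingEnd ℂ).injective (sub_eq_zero.1 h4)

/-- The Bergman kernel function of `Ω`: the kernel with the reproducing property whenever there is
one (an arbitrary function otherwise). -/
noncomputable def bergmanKernel {n : ℕ} (Ω : Set (Fin n → ℂ)) :
    (Fin n → ℂ) → (Fin n → ℂ) → ℂ :=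
  Classical.epsilon (IsBergmanKernel Ω)

/-- The domain `|z₁| + |z₂| + |z₃| < 1` in `ℂ³`. -/
def domainD : Set (Fin 3 → ℂ) :=
  {z | ‖z 0‖ + ‖z 1‖ + ‖z 2‖ < 1}

/-- The domain `|z₁| + |z₂|^{2/p} < 1` in `ℂ²`. -/
def domainOmega (p : ℝ) : Set (Fin 2 → ℂ) :=
  {z | ‖z 0‖ + ‖z 1‖ ^ (2 / p) < 1}

/-! Both domains are complete Reinhardt, so on the first axis only powers of the first coordinate
contribute to the kernel: it is `∑ (z * conj w) ^ k / m k`, with `m k` the integral of `‖w 0‖ ^ (2 *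
k)` over the domain (`IsCompleteReinhardt.bergmanKernel_single`).

By Fubini, `m k` depends only on the volumes of the fibres over the first coordinate. Over `z` in
the unit disc the fibre of `domainD` is an ℓ¹ ball in ℂ² of volume `(π² / 6) (1 - ‖z‖)⁴`, and that
of `domainOmega 4` is a disc of area `π (1 - ‖z‖)⁴`. Hence both kernels are multiples of one series
`axisKernel`, with ratio `6 / π`.

The moments of `(1 - ‖z‖)⁴` are beta integrals whose reciprocals are multiples of the binomials `(2k
+ 6).choose 5`. These are the odd coefficients of `(1 - x)⁻⁶`, so `x * axisKernel (x ^ 2)` is a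
multiple of `(1 - x)⁻⁶ - (1 + x)⁻⁶` (`mul_axisKernel_sq`). Its zeroes are read off from the sixth
roots of unity.

Existence of the kernels is the classical argument: point evaluations are bounded in `L²`, so the
Bergman space is closed and the Riesz representation theorem applies. -/

open Filter Metric Topology Set

/-! ### Uniform limits of holomorphic functions on complex normed spaces. -/

/-- Cauchy's estimate for the derivative of a holomorphic function on a complex normed space. -/
theorem norm_fderiv_le_of_norm_le_on_ball {E : Type*} [NormedAddCommGroup E] [NormedSpace ℂ E]
    {f : E → ℂ} {y : E} {R C : ℝ} (hR : 0 < R) (hC : 0 ≤ C)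
    (hf : DifferentiableOn ℂ f (ball y (2 * R))) (hb : ∀ x ∈ ball y (2 * R), ‖f x‖ ≤ C) :
    ‖fderiv ℂ f y‖ ≤ C / R := by
  refine ContinuousLinearMap.opNorm_le_of_unit_norm (by positivity) fun v hv => ?_
  -- The one-variable Cauchy estimate is applied on the complex line through `y` in direction `v`;
  -- the radius `2 * R` leaves room for the closed disc of radius `R`.
  have hline : ∀ ζ ∈ closedBall (0 : ℂ) R, y + ζ • v ∈ ball y (2 * R) := by
    intro ζ hζ
    rw [mem_closedBall_zero_iff] at hζ
    rw [mem_ball_iff_norm, add_sub_cancel_left, norm_smul, hv]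
    linarith
  have hl : ∀ ζ : ℂ, HasDerivAt (fun ζ : ℂ => y + ζ • v) v ζ := fun ζ => by
    simpa using ((hasDerivAt_id ζ).smul_const v).const_add y
  have hd : DifferentiableOn ℂ (fun ζ : ℂ => f (y + ζ • v)) (closedBall 0 R) := fun ζ hζ =>
    (((hf.differentiableAt (isOpen_ball.mem_nhds (hline ζ hζ))).hasFDerivAt.comp_hasDerivAt ζ
      (hl ζ)).differentiableAt).differentiableWithinAt
  have h0 : y + (0 : ℂ) • v ∈ ball y (2 * R) := hline 0 (by simp [hR.le])
  have hder : HasDerivAt (fun ζ : ℂ => f (y + ζ • v)) (fderiv ℂ f (y + (0 : ℂ) • v) v) 0 :=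
    (hf.differentiableAt (isOpen_ball.mem_nhds h0)).hasFDerivAt.comp_hasDerivAt 0 (hl 0)
  rw [zero_smul, add_zero] at hder
  rw [← hder.deriv]
  exact Complex.norm_deriv_le_of_forall_mem_sphere_norm_le hR (hd.diffContOnCl_ball subset_rfl)
    fun ζ hζ => hb _ (hline ζ (sphere_subset_closedBall hζ))

/-- A uniform limit of holomorphic functions on a ball is holomorphic at the centre. -/
theorem differentiableAt_of_tendstoUniformlyOn_ball {E : Type*} [NormedAddCommGroup E]
    [NormedSpace ℂ E] {F : ℕ → E → ℂ} {f : E → ℂ} {x : E} {r : ℝ} (hr : 0 < r)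
    (hF : ∀ n, DifferentiableOn ℂ (F n) (ball x r)) (h : TendstoUniformlyOn F f atTop (ball x r)) :
    DifferentiableAt ℂ f x := by
  have hsub : ∀ y ∈ ball x (r / 2), ball y (2 * (r / 4)) ⊆ ball x r := fun y hy => by
    apply ball_subset_ball'
    rw [mem_ball] at hy
    linarith
  have hdiff : ∀ n, ∀ y ∈ ball x (r / 2), DifferentiableAt ℂ (F n) y := fun n y hy =>
    (hF n).differentiableAt (isOpen_ball.mem_nhds (ball_subset_ball (by linarith) hy))
  -- Cauchy's estimate for the differences `F m - F n` makes the derivatives uniformly Cauchy on the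
  -- half ball.
  have hc : UniformCauchySeqOn (fun n => fderiv ℂ (F n)) atTop (ball x (r / 2)) := by
    have hu := h.uniformCauchySeqOn
    rw [Metric.uniformCauchySeqOn_iff] at hu ⊢
    intro ε hε
    obtain ⟨N, hN⟩ := hu (ε * (r / 4) / 2) (by positivity)
    refine ⟨N, fun m hm n hn y hy => ?_⟩
    rw [dist_eq_norm, ← fderiv_sub (hdiff m y hy) (hdiff n y hy)]
    refine (norm_fderiv_le_of_norm_le_on_ball (R := r / 4) (C := ε * (r / 4) / 2) (by positivity)
      (by positivity) (((hF m).sub (hF n)).mono (hsub y hy)) fun w hw => ?_).trans_lt ?_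
    · have := hN m hm n hn w (hsub y hy hw)
      rw [dist_eq_norm] at this
      exact this.le
    · rw [div_lt_iff₀ (by positivity)]
      have : 0 < ε * (r / 4) := by positivity
      linarith
  have hlim : ∀ y ∈ ball x (r / 2), ∃ L, Tendsto (fun n => fderiv ℂ (F n) y) atTop (𝓝 L) :=
    fun y hy => cauchySeq_tendsto_of_complete (hc.cauchySeq hy)
  choose! G hG using hlim
  exact (hasFDerivAt_of_tendstoUniformlyOn isOpen_ball (hc.tendstoUniformlyOn_of_tendsto hG)
    (fun n y hy => (hdiff n y hy).hasFDerivAt)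
    (fun y hy => h.tendsto_at (ball_subset_ball (by linarith) hy))
    (mem_ball_self (by linarith))).differentiableAt

/-! ### Circle averages and mean value properties. -/

/-- Averaging an integrable function over a circle of measure preserving maps. -/
theorem integral_intervalIntegral_comp_of_measurePreserving {X : Type*} [MeasurableSpace X]
    {μ : Measure X} [SFinite μ] {R : ℝ → X → X} (hR : Measurable (Function.uncurry R))
    (hμ : ∀ θ, MeasurePreserving (R θ) μ μ) {h : X → ℂ} (hh : Integrable h μ) :
    Integrable (fun w => ∫ θ in (0 : ℝ)..2 * Real.pi, h (R θ w)) μ ∧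
      ∫ w, (∫ θ in (0 : ℝ)..2 * Real.pi, h (R θ w)) ∂μ = 2 * Real.pi * ∫ w, h w ∂μ := by
  have hpi : (0 : ℝ) ≤ 2 * Real.pi := by positivity
  set ν : Measure ℝ := volume.restrict (Ioc 0 (2 * Real.pi)) with hν
  -- The shear `(θ, w) ↦ (θ, R θ w)` preserves the product measure, which gives the joint
  -- integrability needed for Fubini.
  have hskew : MeasurePreserving (fun p : ℝ × X => (p.1, R p.1 p.2)) (ν.prod μ) (ν.prod μ) :=
    (MeasurePreserving.id ν).skew_product hR (Eventually.of_forall fun θ => (hμ θ).map_eq)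
  have hint : Integrable (fun p : ℝ × X => h (R p.1 p.2)) (ν.prod μ) :=
    hskew.integrable_comp_of_integrable (g := fun p : ℝ × X => h p.2) (hh.comp_snd ν)
  simp only [intervalIntegral.integral_of_le hpi]
  refine ⟨hint.integral_prod_right, ?_⟩
  rw [← integral_prod_symm _ hint, integral_prod _ hint]
  have : ∀ θ, ∫ w, h (R θ w) ∂μ = ∫ w, h w ∂μ := fun θ => by
    conv_rhs => rw [← (hμ θ).map_eq]
    rw [integral_map (hμ θ).aemeasurable]
    rw [(hμ θ).map_eq]
    exact hh.1
  simp [this, hν, hpi]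

/-- Cauchy's formula for the `k`-th Taylor coefficient, with the unit circle parametrised by angle.
-/
theorem integral_exp_mul_eq_iteratedDeriv {G : ℂ → ℂ} (hG : DifferentiableOn ℂ G (closedBall 0 1))
    (k : ℕ) :
    ∫ θ in (0 : ℝ)..2 * Real.pi, G (Complex.exp (θ * Complex.I)) *
      Complex.exp (-(θ * Complex.I)) ^ k =
      2 * Real.pi * (iteratedDeriv k G 0 / k.factorial) := by
  have h := DiffContOnCl.circleIntegral_one_div_sub_center_pow_smul (R := 1) one_pos k
    (hG.diffContOnCl_ball subset_rfl)
  simp only [circleIntegral, deriv_circleMap, circleMap, Complex.ofReal_one, one_mul, zero_add,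
    sub_zero, smul_eq_mul] at h
  have e : ∀ θ : ℝ, Complex.exp (θ * Complex.I) * Complex.I *
      (1 / Complex.exp (θ * Complex.I) ^ (k + 1) * G (Complex.exp (θ * Complex.I))) =
      Complex.I * (G (Complex.exp (θ * Complex.I)) * Complex.exp (-(θ * Complex.I)) ^ k) := by
    intro θ
    rw [Complex.exp_neg]
    have hu := Complex.exp_ne_zero (θ * Complex.I)
    generalize Complex.exp (θ * Complex.I) = u at hu
    rw [inv_pow, pow_succ]
    field_simp
  simp only [e, intervalIntegral.integral_const_mul] at h
  refine mul_left_cancel₀ Complex.I_ne_zero (h.trans ?_)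
  ring

theorem integral_exp_eq_apply_zero {G : ℂ → ℂ} (hG : DifferentiableOn ℂ G (closedBall 0 1)) :
    ∫ θ in (0 : ℝ)..2 * Real.pi, G (Complex.exp (θ * Complex.I)) = 2 * Real.pi * G 0 := by
  simpa using integral_exp_mul_eq_iteratedDeriv hG 0

theorem iteratedDeriv_comp_mul_left (f : ℂ → ℂ) (w : ℂ) (k : ℕ) (x : ℂ) :
    iteratedDeriv k (fun ζ => f (w * ζ)) x = w ^ k * iteratedDeriv k f (w * x) := by
  induction k generalizing f with
  | zero => simp
  | succ k ih =>
    have : deriv (fun ζ => f (w * ζ)) = fun ζ => w * deriv f (w * ζ) := by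
      ext ζ
      simp [deriv_comp_mul_left]
    rw [iteratedDeriv_succ', iteratedDeriv_succ', this, iteratedDeriv_const_mul_field, ih, pow_succ]
    ring

/-- Multiplying the coordinates by numbers of modulus one preserves the volume. -/
theorem measurePreserving_mul_of_norm_eq_one {n : ℕ} {c : Fin n → ℂ} (hc : ∀ i, ‖c i‖ = 1) :
    MeasurePreserving (fun w : Fin n → ℂ => c * w) volume volume :=
  volume_preserving_pi fun i =>
    (rotation ⟨c i, mem_sphere_zero_iff_norm.2 (hc i)⟩).measurePreserving

/-- The mean value property of holomorphic functions over polydiscs. -/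
theorem setIntegral_ball_eq {n : ℕ} {f : (Fin n → ℂ) → ℂ} {z : Fin n → ℂ} {r : ℝ}
    (hf : DifferentiableOn ℂ f (ball z r)) (hi : IntegrableOn f (ball z r)) :
    ∫ w in ball z r, f w = volume.real (ball z r) * f z := by
  have htr : MeasurePreserving (fun u : Fin n → ℂ => z + u) (volume.restrict (ball 0 r))
      (volume.restrict (ball z r)) := by
    have := (measurePreserving_add_left volume z).restrict_preimage
      (measurableSet_ball (x := z) (ε := r))
    simpa using this
  have hemb : MeasurableEmbedding (fun u : Fin n → ℂ => z + u) := measurableEmbedding_addLeft z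
  have h0 : ∫ u in ball 0 r, f (z + u) = ∫ w in ball z r, f w := htr.integral_comp hemb f
  have hi0 : Integrable (fun u => f (z + u)) (volume.restrict (ball 0 r)) :=
    htr.integrable_comp_of_integrable hi
  have hR : ∀ θ : ℝ, MeasurePreserving
      (fun u : Fin n → ℂ => (fun _ => Complex.exp (θ * Complex.I)) * u)
      (volume.restrict (ball 0 r)) (volume.restrict (ball 0 r)) := fun θ => by
    have := (measurePreserving_mul_of_norm_eq_one (n := n)
      (c := fun _ => Complex.exp (θ * Complex.I))
      fun _ => Complex.norm_exp_ofReal_mul_I θ).restrict_preimage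
      (measurableSet_ball (x := 0) (ε := r))
    convert this using 2
    ext u
    have : (fun _ => Complex.exp (θ * Complex.I)) * u = Complex.exp (θ * Complex.I) • u := rfl
    rw [mem_preimage, mem_ball_zero_iff, mem_ball_zero_iff, this, norm_smul,
      Complex.norm_exp_ofReal_mul_I, one_mul]
  have hav := (integral_intervalIntegral_comp_of_measurePreserving
    (R := fun (θ : ℝ) (u : Fin n → ℂ) => (fun _ => Complex.exp (θ * Complex.I)) * u)
    (Continuous.measurable (by simp only [Function.uncurry_def]; fun_prop)) hR hi0).2
  have hin : ∀ u ∈ ball (0 : Fin n → ℂ) r, ∫ θ in (0 : ℝ)..2 * Real.pi,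
      f (z + (fun _ => Complex.exp (θ * Complex.I)) * u) = 2 * Real.pi * f z := by
    intro u hu
    have hG : DifferentiableOn ℂ (fun ζ : ℂ => f (z + ζ • u)) (closedBall 0 1) := by
      refine hf.comp (Differentiable.differentiableOn (by fun_prop)) fun ζ hζ => ?_
      rw [mem_closedBall_zero_iff] at hζ
      rw [mem_ball_zero_iff] at hu
      rw [mem_ball_iff_norm, add_sub_cancel_left, norm_smul]
      exact (mul_le_of_le_one_left (norm_nonneg u) hζ).trans_lt hu
    have := integral_exp_eq_apply_zero hG
    rwa [zero_smul, add_zero] at this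
  rw [setIntegral_congr_fun measurableSet_ball hin, h0, integral_const, Complex.real_smul,
    measureReal_restrict_apply_univ] at hav
  have hb : volume.real (ball (0 : Fin n → ℂ) r) = volume.real (ball z r) := by
    rw [measureReal_def, measureReal_def, Measure.addHaar_ball_center volume z]
  have h2 : (2 * Real.pi : ℂ) ≠ 0 := by simp [Real.pi_ne_zero]
  refine mul_left_cancel₀ h2 (hav.symm.trans ?_)
  rw [hb]
  ring

/-! ### Existence of the Bergman kernel. -/

/-- Point evaluations are locally uniformly bounded in terms of the `L²` norm. -/
theorem exists_norm_le_mul_eLpNorm (n : ℕ) {r : ℝ} (hr : 0 < r) :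
    ∃ C : ℝ, ∀ (Ω : Set (Fin n → ℂ)) (f : (Fin n → ℂ) → ℂ) (z : Fin n → ℂ),
      ball z r ⊆ Ω → MemBergmanSpace Ω f →
      ‖f z‖ ≤ C * (eLpNorm f 2 (volume.restrict Ω)).toReal := by
  set V := volume.real (ball (0 : Fin n → ℂ) r) with hVdef
  have hV : 0 < V := ENNReal.toReal_pos (measure_ball_pos volume 0 hr).ne' measure_ball_lt_top.ne
  -- The mean value property over the polydisc bounds `V * ‖f z‖` by an `L¹` norm, and Hölder on
  -- this set of finite measure costs the power `1 / 2` of its volume.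
  refine ⟨V⁻¹ * (volume (ball (0 : Fin n → ℂ) r) ^
    (1 / (1 : ENNReal).toReal - 1 / (2 : ENNReal).toReal)).toReal, fun Ω f z hz hf => ?_⟩
  have hb : volume (ball (0 : Fin n → ℂ) r) = volume (ball z r) :=
    (Measure.addHaar_ball_center volume z r).symm
  have hVz : volume.real (ball z r) = V := by rw [hVdef, measureReal_def, measureReal_def, hb]
  have hfin : volume (ball z r) ≠ ⊤ := measure_ball_lt_top.ne
  have : IsFiniteMeasure (volume.restrict (ball z r)) := ⟨by simpa using measure_ball_lt_top⟩
  have h2 : MemLp f 2 (volume.restrict (ball z r)) :=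
    hf.2.mono_measure (Measure.restrict_mono hz le_rfl)
  have hint : IntegrableOn f (ball z r) := h2.integrable (by norm_num)
  have hmv := setIntegral_ball_eq (hf.1.mono hz) hint
  rw [hVz] at hmv
  have h1 : V * ‖f z‖ ≤ ∫ w in ball z r, ‖f w‖ := by
    calc V * ‖f z‖ = ‖∫ w in ball z r, f w‖ := by
          rw [hmv, norm_mul, Complex.norm_real, Real.norm_of_nonneg hV.le]
      _ ≤ _ := norm_integral_le_integral_norm _
  have h3 : ∫ w in ball z r, ‖f w‖ = (eLpNorm f 1 (volume.restrict (ball z r))).toReal := by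
    rw [integral_norm_eq_lintegral_enorm hint.1, eLpNorm_one_eq_lintegral_enorm]
  have h4 : eLpNorm f 1 (volume.restrict (ball z r)) ≤ eLpNorm f 2 (volume.restrict Ω) *
      volume (ball z r) ^ (1 / (1 : ENNReal).toReal - 1 / (2 : ENNReal).toReal) := by
    refine (eLpNorm_le_eLpNorm_mul_rpow_measure_univ (q := 2) (by norm_num) h2.1).trans ?_
    rw [Measure.restrict_apply_univ]
    gcongr
  have h5 := ENNReal.toReal_mono (ENNReal.mul_ne_top hf.2.eLpNorm_ne_top
    (ENNReal.rpow_ne_top_of_nonneg (by norm_num) hfin)) h4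
  rw [ENNReal.toReal_mul, ← h3, ← hb] at h5
  rw [mul_assoc, inv_mul_eq_div, le_div_iff₀ hV]
  linarith

/-- The Bergman space as a subspace of `L²`. -/
noncomputable def bergmanSubmodule {n : ℕ} (Ω : Set (Fin n → ℂ)) :
    Submodule ℂ (Lp ℂ 2 (volume.restrict Ω)) where
  carrier := {g | ∃ f, DifferentiableOn ℂ f Ω ∧ g =ᵐ[volume.restrict Ω] f}
  add_mem' := by
    rintro g₁ g₂ ⟨f₁, hf₁, h₁⟩ ⟨f₂, hf₂, h₂⟩
    exact ⟨f₁ + f₂, hf₁.add hf₂, (Lp.coeFn_add g₁ g₂).trans (h₁.add h₂)⟩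
  zero_mem' := ⟨0, differentiableOn_const 0, Lp.coeFn_zero _ _ _⟩
  smul_mem' := by
    rintro c g ⟨f, hf, h⟩
    exact ⟨c • f, hf.const_smul c, (Lp.coeFn_smul c g).trans (h.const_smul c)⟩

theorem memBergmanSpace_of_ae_eq {n : ℕ} {Ω : Set (Fin n → ℂ)} {f : (Fin n → ℂ) → ℂ}
    {g : Lp ℂ 2 (volume.restrict Ω)} (hf : DifferentiableOn ℂ f Ω)
    (h : g =ᵐ[volume.restrict Ω] f) : MemBergmanSpace Ω f :=
  ⟨hf, (memLp_congr_ae h).1 (Lp.memLp g)⟩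

/-- The evaluation bound turns `L²` convergence into locally uniform convergence, so the pointwise
limit is holomorphic; an a.e. convergent subsequence identifies it with the `L²` limit. -/
theorem isClosed_bergmanSubmodule {n : ℕ} {Ω : Set (Fin n → ℂ)} (hΩ : IsOpen Ω) :
    IsClosed (bergmanSubmodule Ω : Set (Lp ℂ 2 (volume.restrict Ω))) := by
  refine IsSeqClosed.isClosed fun g g₀ hg hlim => ?_
  choose f hf hfg using hg
  have hcauchy := hlim.cauchySeq
  rw [Metric.cauchySeq_iff] at hcauchy
  have hunif : ∀ z ∈ Ω, ∃ r > 0, ball z r ⊆ Ω ∧ UniformCauchySeqOn f atTop (ball z r) := by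
    intro z hz
    obtain ⟨ε, hε, hball⟩ := Metric.isOpen_iff.1 hΩ z hz
    obtain ⟨C, hC⟩ := exists_norm_le_mul_eLpNorm n (half_pos hε)
    refine ⟨ε / 2, half_pos hε, (ball_subset_ball (by linarith)).trans hball, ?_⟩
    rw [Metric.uniformCauchySeqOn_iff]
    intro δ hδ
    obtain ⟨N, hN⟩ := hcauchy (δ / (|C| + 1)) (by positivity)
    refine ⟨N, fun m hm k hk x hx => ?_⟩
    have hae : (g m - g k : Lp ℂ 2 (volume.restrict Ω)) =ᵐ[volume.restrict Ω]
        f m - f k := (Lp.coeFn_sub _ _).trans ((hfg m).sub (hfg k))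
    have hx' : ball x (ε / 2) ⊆ Ω := (ball_subset_ball' (by
      rw [mem_ball] at hx; linarith)).trans hball
    have hle := hC Ω (f m - f k) x hx' (memBergmanSpace_of_ae_eq ((hf m).sub (hf k)) hae)
    rw [← eLpNorm_congr_ae hae, ← Lp.norm_def, ← dist_eq_norm] at hle
    have hN' := hN m hm k hk
    rw [lt_div_iff₀ (by positivity)] at hN'
    rw [dist_eq_norm]
    calc ‖f m x - f k x‖ ≤ C * dist (g m) (g k) := hle
      _ ≤ |C| * dist (g m) (g k) := by gcongr; exact le_abs_self C
      _ ≤ dist (g m) (g k) * (|C| + 1) := by nlinarith [dist_nonneg (x := g m) (y := g k)]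
      _ < δ := hN'
  have hpt : ∀ z ∈ Ω, ∃ L, Tendsto (fun k => f k z) atTop (𝓝 L) := fun z hz => by
    obtain ⟨r, hr, -, hu⟩ := hunif z hz
    exact cauchySeq_tendsto_of_complete (hu.cauchySeq (mem_ball_self hr))
  choose! F hF using hpt
  refine ⟨F, fun z hz => ?_, ?_⟩
  · obtain ⟨r, hr, hsub, hu⟩ := hunif z hz
    exact (differentiableAt_of_tendstoUniformlyOn_ball hr (fun k => (hf k).mono hsub)
      (hu.tendstoUniformlyOn_of_tendsto fun x hx => hF x (hsub hx))).differentiableWithinAt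
  · obtain ⟨φ, hφ, hae⟩ := (tendstoInMeasure_of_tendsto_Lp hlim).exists_seq_tendsto_ae
    have hall : ∀ᵐ x ∂volume.restrict Ω, ∀ k, g k x = f k x := ae_all_iff.2 hfg
    filter_upwards [hae, hall, ae_restrict_mem hΩ.measurableSet] with x hx hx' hxΩ
    simp only [hx'] at hx
    exact tendsto_nhds_unique hx ((hF x hxΩ).comp hφ.tendsto_atTop)

/-- Every open set has a Bergman kernel. -/
theorem exists_isBergmanKernel {n : ℕ} {Ω : Set (Fin n → ℂ)} (hΩ : IsOpen Ω) :
    ∃ K, IsBergmanKernel Ω K := by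
  suffices h : ∀ z ∈ Ω, ∃ k : (Fin n → ℂ) → ℂ, MemBergmanSpace Ω (fun w => conj (k w)) ∧
      ∀ f, MemBergmanSpace Ω f → f z = ∫ w in Ω, f w * k w by
    choose! K hK using h
    exact ⟨K, hK⟩
  intro z hz
  have : CompleteSpace (bergmanSubmodule Ω) :=
    (isClosed_bergmanSubmodule hΩ).completeSpace_coe
  obtain ⟨r, hr, hball⟩ := Metric.isOpen_iff.1 hΩ z hz
  obtain ⟨C, hC⟩ := exists_norm_le_mul_eLpNorm n hr
  have hex : ∀ g : bergmanSubmodule Ω, ∃ f, DifferentiableOn ℂ f Ω ∧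
      g.1 =ᵐ[volume.restrict Ω] f := fun g => g.2
  choose rep hrep hae using hex
  -- Holomorphic representatives that agree a.e. agree on all of `Ω`, so evaluation at `z` is linear
  -- whichever representatives are chosen.
  have huniq : ∀ f₁ f₂ : (Fin n → ℂ) → ℂ, DifferentiableOn ℂ f₁ Ω → DifferentiableOn ℂ f₂ Ω →
      f₁ =ᵐ[volume.restrict Ω] f₂ → f₁ z = f₂ z := fun f₁ f₂ h₁ h₂ h =>
    Measure.eqOn_open_of_ae_eq h hΩ h₁.continuousOn h₂.continuousOn hz
  let ev : bergmanSubmodule Ω →ₗ[ℂ] ℂ :=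
    { toFun := fun g => rep g z
      map_add' := fun g₁ g₂ => huniq _ (rep g₁ + rep g₂) (hrep _) ((hrep _).add (hrep _))
        ((hae _).symm.trans ((Lp.coeFn_add g₁.1 g₂.1).trans ((hae g₁).add (hae g₂))))
      map_smul' := fun c g => huniq _ (c • rep g) (hrep _) ((hrep _).const_smul c)
        ((hae _).symm.trans ((Lp.coeFn_smul c g.1).trans ((hae g).const_smul c))) }
  let evc : StrongDual ℂ (bergmanSubmodule Ω) := ev.mkContinuous C fun g => by
    have := hC Ω (rep g) z hball (memBergmanSpace_of_ae_eq (hrep g) (hae g))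
    rwa [← eLpNorm_congr_ae (hae g), ← Lp.norm_def] at this
  let k := (InnerProductSpace.toDual ℂ (bergmanSubmodule Ω)).symm evc
  refine ⟨fun w => conj (rep k w), ?_, fun f hf => ?_⟩
  · simpa using memBergmanSpace_of_ae_eq (hrep k) (hae k)
  · let g : bergmanSubmodule Ω := ⟨hf.2.toLp f, f, hf.1, hf.2.coeFn_toLp⟩
    have h1 : inner ℂ k g = rep g z := InnerProductSpace.toDual_symm_apply
    have h2 : rep g z = f z := huniq _ _ (hrep g) hf.1 ((hae g).symm.trans hf.2.coeFn_toLp)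
    rw [← h2, ← h1, Submodule.coe_inner, L2.inner_def]
    refine integral_congr_ae ?_
    filter_upwards [hae k, hf.2.coeFn_toLp] with w hw hw'
    rw [hw, RCLike.inner_apply]
    simp only [g, hw']

theorem isBergmanKernel_bergmanKernel {n : ℕ} {Ω : Set (Fin n → ℂ)} (hΩ : IsOpen Ω) :
    IsBergmanKernel Ω (bergmanKernel Ω) :=
  Classical.epsilon_spec (exists_isBergmanKernel hΩ)

/-- A function that reproduces the values at a single point is the Bergman kernel there. -/
theorem bergmanKernel_eq_of_reproducing {n : ℕ} {Ω : Set (Fin n → ℂ)} (hΩ : IsOpen Ω)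
    {z : Fin n → ℂ} (hz : z ∈ Ω) {k : (Fin n → ℂ) → ℂ}
    (hk : MemBergmanSpace Ω (fun w => conj (k w)))
    (hrep : ∀ f, MemBergmanSpace Ω f → f z = ∫ w in Ω, f w * k w) {w : Fin n → ℂ} (hw : w ∈ Ω) :
    bergmanKernel Ω z w = k w := by
  classical
  have hK := isBergmanKernel_bergmanKernel hΩ
  -- Replacing only the row at `z` again gives a kernel, to which uniqueness applies.
  have hL : IsBergmanKernel Ω (Function.update (bergmanKernel Ω) z k) := by
    intro x hx
    by_cases h : x = z
    · subst h
      simpa using ⟨hk, hrep⟩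
    · simpa [Function.update_of_ne h] using hK x hx
  simpa using IsBergmanKernel.unique hΩ hK hL hz hw

/-! ### Complete Reinhardt domains and the kernel on the first axis. -/

/-- Complete Reinhardt domains. -/
def IsCompleteReinhardt {n : ℕ} (Ω : Set (Fin n → ℂ)) : Prop :=
  ∀ w ∈ Ω, ∀ v : Fin n → ℂ, (∀ i, ‖v i‖ ≤ ‖w i‖) → v ∈ Ω

theorem IsCompleteReinhardt.measurePreserving_mul {n : ℕ} {Ω : Set (Fin n → ℂ)}
    (hR : IsCompleteReinhardt Ω) (hΩ : IsOpen Ω) {c : Fin n → ℂ} (hc : ∀ i, ‖c i‖ = 1) :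
    MeasurePreserving (fun w => c * w) (volume.restrict Ω) (volume.restrict Ω) := by
  have := (measurePreserving_mul_of_norm_eq_one hc).restrict_preimage hΩ.measurableSet
  convert this using 2
  ext w
  exact ⟨fun h => hR _ h _ fun i => by simp [hc], fun h => hR _ h _ fun i => by simp [hc]⟩

theorem differentiable_single {n : ℕ} (i : Fin n) :
    Differentiable ℂ (fun ζ : ℂ => (Pi.single i ζ : Fin n → ℂ)) :=
  (ContinuousLinearMap.single ℂ (fun _ : Fin n => ℂ) i).differentiable

section

variable {n : ℕ} {Ω : Set (Fin (n + 1) → ℂ)}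

theorem IsCompleteReinhardt.norm_lt_one (hR : IsCompleteReinhardt Ω)
    (hdisc : ∀ ζ : ℂ, Pi.single 0 ζ ∈ Ω ↔ ‖ζ‖ < 1) {w : Fin (n + 1) → ℂ} (hw : w ∈ Ω) :
    ‖w 0‖ < 1 := by
  rw [← hdisc]
  refine hR w hw _ fun i => ?_
  by_cases h : i = 0
  · subst h; simp
  · simp [h]

/-- The moments of a holomorphic function along the first coordinate. -/
theorem IsCompleteReinhardt.setIntegral_mul_conj_pow (hR : IsCompleteReinhardt Ω)
    (hΩ : IsOpen Ω) (hdisc : ∀ ζ : ℂ, Pi.single 0 ζ ∈ Ω ↔ ‖ζ‖ < 1)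
    {f : (Fin (n + 1) → ℂ) → ℂ} (hf : DifferentiableOn ℂ f Ω) (hi : IntegrableOn f Ω) (k : ℕ) :
    ∫ w in Ω, f w * conj (w 0) ^ k =
      iteratedDeriv k (fun ζ : ℂ => f (Pi.single 0 ζ)) 0 / k.factorial *
        ((∫ w in Ω, ‖w 0‖ ^ (2 * k) : ℝ) : ℂ) := by
  have h2pi : (2 * Real.pi : ℂ) ≠ 0 := by simp [Real.pi_ne_zero]
  have hexp : ∀ θ : ℝ, ‖Complex.exp (θ * Complex.I)‖ = 1 := Complex.norm_exp_ofReal_mul_I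
  set h₁ : (Fin (n + 1) → ℂ) → ℂ := fun w => f w * conj (w 0) ^ k with hh₁
  set h₂ : (Fin (n + 1) → ℂ) → ℂ := fun w => f (Pi.single 0 (w 0)) * conj (w 0) ^ k with hh₂
  have hi₁ : Integrable h₁ (volume.restrict Ω) := by
    refine hi.mul_bdd (c := 1) (Continuous.aestronglyMeasurable (by fun_prop)) ?_
    filter_upwards [ae_restrict_mem hΩ.measurableSet] with w hw
    rw [norm_pow, RCLike.norm_conj]
    exact pow_le_one₀ (norm_nonneg _) (hR.norm_lt_one hdisc hw).le
  -- Rotating all coordinates except the first replaces `f w` by its value at the projection of `w`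
  -- to the first axis.
  obtain ⟨hA, hA'⟩ := integral_intervalIntegral_comp_of_measurePreserving
    (R := fun (θ : ℝ) (w : Fin (n + 1) → ℂ) =>
      (fun i => if i = 0 then 1 else Complex.exp (θ * Complex.I)) * w)
    (Continuous.measurable (by
      simp only [Function.uncurry_def]
      refine continuous_pi fun i => ?_
      by_cases h : i = 0 <;> simp only [Pi.mul_apply, h, if_true, if_false] <;> fun_prop))
    (fun θ => hR.measurePreserving_mul hΩ fun i => by split_ifs <;> simp [hexp]) hi₁
  have hin₁ : ∀ w ∈ Ω, ∫ θ in (0 : ℝ)..2 * Real.pi,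
      h₁ ((fun i => if i = 0 then 1 else Complex.exp (θ * Complex.I)) * w) =
        2 * Real.pi * h₂ w := by
    intro w hw
    have hG : DifferentiableOn ℂ (fun ζ : ℂ => h₁ ((fun i => if i = 0 then 1 else ζ) * w))
        (closedBall 0 1) := by
      simp only [hh₁, Pi.mul_apply, if_true, one_mul]
      refine DifferentiableOn.mul_const (hf.comp (Differentiable.differentiableOn ?_) ?_) _
      · refine differentiable_pi.2 fun i => ?_
        by_cases h : i = 0 <;> simp only [Pi.mul_apply, h, if_true, if_false] <;> fun_prop
      · intro ζ hζ
        rw [mem_closedBall_zero_iff] at hζ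
        refine hR w hw _ fun i => ?_
        change ‖(if i = 0 then 1 else ζ) * w i‖ ≤ _
        rw [norm_mul]
        refine mul_le_of_le_one_left (norm_nonneg _) ?_
        split_ifs
        · simp
        · exact hζ
    rw [integral_exp_eq_apply_zero hG]
    refine congrArg (2 * (Real.pi : ℂ) * ·) ?_
    simp only [hh₁, hh₂, Pi.mul_apply, if_true, one_mul]
    refine congrArg (f · * conj (w 0) ^ k) ?_
    ext i
    by_cases h : i = 0
    · subst h; simp
    · simp [h]
  have hae₁ := (ae_restrict_mem (μ := volume) hΩ.measurableSet).mono hin₁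
  rw [integral_congr_ae hae₁, integral_const_mul] at hA'
  -- `h₂` is, up to a constant, the average of `h₁`, so its integrability comes with the averaging
  -- lemma.
  have hi₂ : Integrable h₂ (volume.restrict Ω) := by
    have := (hA.congr hae₁).const_mul (2 * Real.pi : ℂ)⁻¹
    simpa only [inv_mul_cancel_left₀ h2pi] using this
  -- Rotating the first coordinate now isolates the `k`-th Taylor coefficient on the axis.
  have hB' := (integral_intervalIntegral_comp_of_measurePreserving
    (R := fun (θ : ℝ) (w : Fin (n + 1) → ℂ) =>
      (fun i => if i = 0 then Complex.exp (θ * Complex.I) else 1) * w)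
    (Continuous.measurable (by
      simp only [Function.uncurry_def]
      refine continuous_pi fun i => ?_
      by_cases h : i = 0 <;> simp only [Pi.mul_apply, h, if_true, if_false] <;> fun_prop))
    (fun θ => hR.measurePreserving_mul hΩ fun i => by split_ifs <;> simp [hexp]) hi₂).2
  have hin₂ : ∀ w ∈ Ω, ∫ θ in (0 : ℝ)..2 * Real.pi,
      h₂ ((fun i => if i = 0 then Complex.exp (θ * Complex.I) else 1) * w) =
        2 * Real.pi * (iteratedDeriv k (fun ζ : ℂ => f (Pi.single 0 ζ)) 0 / k.factorial *
          ((‖w 0‖ ^ (2 * k) : ℝ) : ℂ)) := by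
    intro w hw
    have hG : DifferentiableOn ℂ (fun ζ : ℂ => f (Pi.single 0 (w 0 * ζ))) (closedBall 0 1) := by
      refine hf.comp ((differentiable_single 0).comp (by fun_prop)).differentiableOn fun ζ hζ => ?_
      rw [mem_closedBall_zero_iff] at hζ
      rw [hdisc, norm_mul]
      exact (mul_le_of_le_one_right (norm_nonneg _) hζ).trans_lt (hR.norm_lt_one hdisc hw)
    have hint := integral_exp_mul_eq_iteratedDeriv hG k
    rw [iteratedDeriv_comp_mul_left (fun ζ => f (Pi.single 0 ζ)), mul_zero] at hint
    have e : ∀ θ : ℝ, h₂ ((fun i => if i = 0 then Complex.exp (θ * Complex.I) else 1) * w) =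
        f (Pi.single 0 (w 0 * Complex.exp (θ * Complex.I))) *
          Complex.exp (-(θ * Complex.I)) ^ k * conj (w 0) ^ k := by
      intro θ
      simp only [hh₂, Pi.mul_apply, if_true, map_mul, ← Complex.exp_conj, Complex.conj_ofReal,
        Complex.conj_I, mul_neg, mul_pow]
      rw [mul_comm (w 0)]
      ring
    simp only [e, intervalIntegral.integral_mul_const, hint]
    have e2 : ((‖w 0‖ ^ (2 * k) : ℝ) : ℂ) = w 0 ^ k * conj (w 0) ^ k := by
      rw [← mul_pow, Complex.mul_conj', pow_mul]
      push_cast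
      rfl
    rw [e2]
    ring
  rw [setIntegral_congr_fun hΩ.measurableSet hin₂, integral_const_mul, integral_const_mul,
    integral_complex_ofReal] at hB'
  rw [← mul_left_cancel₀ h2pi hA', ← mul_left_cancel₀ h2pi hB']

/-- The Bergman kernel along the first coordinate axis, in terms of the moments of the domain. -/
theorem IsCompleteReinhardt.bergmanKernel_single (hR : IsCompleteReinhardt Ω) (hΩ : IsOpen Ω)
    (hfin : volume Ω ≠ ⊤) (hdisc : ∀ ζ : ℂ, Pi.single 0 ζ ∈ Ω ↔ ‖ζ‖ < 1) {m : ℕ → ℝ}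
    (hm : ∀ k, ∫ w in Ω, ‖w 0‖ ^ (2 * k) = m k) (hpos : ∀ k, 0 < m k)
    (hsum : ∀ r : ℝ, 0 ≤ r → r < 1 → Summable fun k => r ^ k / m k) {z w : ℂ}
    (hz : ‖z‖ < 1) (hw : ‖w‖ < 1) :
    bergmanKernel Ω (Pi.single 0 z) (Pi.single 0 w) = ∑' k, (z * conj w) ^ k / m k := by
  have hmC : ∀ k, (m k : ℂ) ≠ 0 := fun k => by exact_mod_cast (hpos k).ne'
  have : IsFiniteMeasure (volume.restrict Ω) := ⟨by simpa using hfin.lt_top⟩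
  have hbd : ∀ k (ζ : ℂ), ζ ∈ ball (0 : ℂ) 1 → ‖(z * conj ζ) ^ k / m k‖ ≤ ‖z‖ ^ k / m k := by
    intro k ζ hζ
    rw [mem_ball_zero_iff] at hζ
    rw [norm_div, Complex.norm_real, Real.norm_of_nonneg (hpos k).le, norm_pow, norm_mul,
      RCLike.norm_conj]
    have := (hpos k).le
    gcongr
    exact mul_le_of_le_one_right (norm_nonneg _) hζ.le
  have hsz := hsum ‖z‖ (norm_nonneg _) hz
  rw [bergmanKernel_eq_of_reproducing hΩ ((hdisc z).2 hz)
    (k := fun v => ∑' k, (z * conj (v 0)) ^ k / m k) ?_ ?_ ((hdisc w).2 hw)]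
  · simp
  · have hd : DifferentiableOn ℂ (fun v : Fin (n + 1) → ℂ =>
        conj (∑' k, (z * conj (v 0)) ^ k / m k)) Ω := by
      have h1 : DifferentiableOn ℂ (fun ζ : ℂ => ∑' k, (conj z * ζ) ^ k / m k) (ball 0 1) := by
        refine Complex.differentiableOn_tsum_of_summable_norm hsz (fun k => by fun_prop)
          isOpen_ball fun k ζ hζ => ?_
        have := hbd k (conj ζ) (by simpa using hζ)
        rw [Complex.conj_conj] at this
        simpa using this
      have h2 := h1.comp (t := ball 0 1) (s := Ω) (f := fun v : Fin (n + 1) → ℂ => v 0)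
        (by fun_prop) fun v hv => by simpa using hR.norm_lt_one hdisc hv
      refine h2.congr fun v _ => ?_
      rw [Complex.conj_tsum]
      simp
    refine ⟨hd, MemLp.of_bound (hd.continuousOn.aestronglyMeasurable hΩ.measurableSet)
      (∑' k, ‖z‖ ^ k / m k) ?_⟩
    filter_upwards [ae_restrict_mem hΩ.measurableSet] with v hv
    rw [RCLike.norm_conj]
    exact tsum_of_norm_bounded hsz.hasSum fun k =>
      hbd k _ (by simpa using hR.norm_lt_one hdisc hv)
  · intro f hf
    have hi : IntegrableOn f Ω := hf.2.integrable (by norm_num)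
    have hF : DifferentiableOn ℂ (fun ζ : ℂ => f (Pi.single 0 ζ)) (ball 0 1) :=
      hf.1.comp (differentiable_single 0).differentiableOn fun ζ hζ => by
        simpa [hdisc] using hζ
    -- Integrating the kernel series term by term against `f` reproduces this Taylor series, the
    -- moments cancelling.
    have ht := Complex.taylorSeries_eq_on_ball' (z := z) (by simpa using hz) hF
    have hpw : ∀ k, ∀ᵐ v ∂volume.restrict Ω,
        ‖(z * conj (v 0)) ^ k / m k‖ ≤ ‖z‖ ^ k / m k := fun k => by
      filter_upwards [ae_restrict_mem hΩ.measurableSet] with v hv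
      exact hbd k _ (by simpa using hR.norm_lt_one hdisc hv)
    have hint : ∀ k, Integrable (fun v => f v * ((z * conj (v 0)) ^ k / m k))
        (volume.restrict Ω) := fun k =>
      hi.mul_bdd (Continuous.aestronglyMeasurable (by fun_prop)) (hpw k)
    have hsm : Summable fun k => ∫ v in Ω, ‖f v * ((z * conj (v 0)) ^ k / m k)‖ := by
      refine Summable.of_nonneg_of_le (fun k => integral_nonneg fun _ => norm_nonneg _)
        (fun k => ?_) (hsz.mul_left (∫ v in Ω, ‖f v‖))
      rw [← integral_mul_const]
      refine integral_mono_ae (hint k).norm (hi.norm.mul_const _) ?_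
      filter_upwards [hpw k] with v hv
      rw [norm_mul]
      gcongr
    have key := (hasSum_integral_of_summable_integral_norm hint hsm).tsum_eq
    simp only [tsum_mul_left] at key
    rw [← key, ← ht]
    refine tsum_congr fun k => ?_
    have e : ∀ v : Fin (n + 1) → ℂ, f v * ((z * conj (v 0)) ^ k / m k) =
        (z ^ k / m k) * (f v * conj (v 0) ^ k) := fun v => by
      rw [mul_pow]; ring
    simp only [e]
    rw [integral_const_mul, hR.setIntegral_mul_conj_pow hΩ hdisc hf.1 hi, hm]
    have := hmC k
    field_simp
    simp

end

/-! ### Moments of the domains and the common axis series. -/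

/-- The beta integral `B(2k + 2, 5)`, up to a factor: the moments of `(1 - ‖z‖) ^ 4` on the disc. -/
noncomputable def discMoment (k : ℕ) : ℝ :=
  2 * Real.pi / (5 * ((2 * k + 1 + 5).choose 5 : ℝ))

theorem discMoment_pos (k : ℕ) : 0 < discMoment k := by
  have : 0 < (2 * k + 1 + 5).choose 5 := Nat.choose_pos (by omega)
  rw [discMoment]
  positivity

theorem choose_five_mul (k : ℕ) : (120 : ℝ) * ((2 * k + 1 + 5).choose 5 : ℝ) =
    (2 * k + 2) * (2 * k + 3) * (2 * k + 4) * (2 * k + 5) * (2 * k + 6) := by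
  have h := Nat.ascFactorial_eq_factorial_mul_choose (2 * k + 1) 5
  simp only [Nat.ascFactorial, Nat.factorial] at h
  have h' := congrArg (Nat.cast : ℕ → ℝ) h
  push_cast at h'
  linarith

theorem intervalIntegral_pow_mul_one_sub_pow_four (k : ℕ) :
    ∫ y in (0 : ℝ)..1, y ^ (2 * k + 1) * (1 - y) ^ 4 =
      (24 : ℝ) / ((2 * k + 2) * (2 * k + 3) * (2 * k + 4) * (2 * k + 5) * (2 * k + 6)) := by
  have e : ∀ y : ℝ, y ^ (2 * k + 1) * (1 - y) ^ 4 =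
      y ^ (2 * k + 1) - 4 * y ^ (2 * k + 2) + 6 * y ^ (2 * k + 3) - 4 * y ^ (2 * k + 4)
        + y ^ (2 * k + 5) := fun y => by ring
  have hi : ∀ (j : ℕ) (c : ℝ), IntervalIntegrable (fun y : ℝ => c * y ^ j) volume 0 1 :=
    fun j c => Continuous.intervalIntegrable (by fun_prop) _ _
  have hi' : ∀ j : ℕ, IntervalIntegrable (fun y : ℝ => y ^ j) volume 0 1 :=
    fun j => Continuous.intervalIntegrable (by fun_prop) _ _
  simp only [e]
  rw [intervalIntegral.integral_add ((((hi' _).sub (hi _ _)).add (hi _ _)).sub (hi _ _)) (hi' _),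
    intervalIntegral.integral_sub (((hi' _).sub (hi _ _)).add (hi _ _)) (hi _ _),
    intervalIntegral.integral_add ((hi' _).sub (hi _ _)) (hi _ _),
    intervalIntegral.integral_sub (hi' _) (hi _ _)]
  simp only [intervalIntegral.integral_const_mul, integral_pow]
  push_cast
  have h : (0 : ℝ) ≤ k := k.cast_nonneg
  have h2 : (2 * k + 1 + 1 : ℝ) ≠ 0 := by positivity
  have h3 : (2 * k + 2 + 1 : ℝ) ≠ 0 := by positivity
  have h4 : (2 * k + 3 + 1 : ℝ) ≠ 0 := by positivity
  have h5 : (2 * k + 4 + 1 : ℝ) ≠ 0 := by positivity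
  have h6 : (2 * k + 5 + 1 : ℝ) ≠ 0 := by positivity
  simp only [one_pow, ne_eq, Nat.add_eq_zero_iff, one_ne_zero, and_false, not_false_eq_true,
    zero_pow, sub_zero]
  field_simp
  ring

/-- Polar coordinates: the Jacobian raises the exponent to `2 * k + 1`, which is why odd-indexed
binomials appear later. -/
theorem integral_norm_pow_mul_max_pow_four (k : ℕ) :
    ∫ z : ℂ, ‖z‖ ^ (2 * k) * max (1 - ‖z‖) 0 ^ 4 = discMoment k := by
  have h := integral_fun_norm_addHaar (volume : Measure ℂ)
    (fun y : ℝ => y ^ (2 * k) * max (1 - y) 0 ^ 4)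
  rw [h, Complex.finrank_real_complex]
  have hb : (volume : Measure ℂ).real (ball 0 1) = Real.pi := by
    rw [measureReal_def, Complex.volume_ball]
    simp
  have hI : ∫ y in Ioi (0 : ℝ), y ^ (2 - 1) • (y ^ (2 * k) * max (1 - y) 0 ^ 4) =
      ∫ y in (0 : ℝ)..1, y ^ (2 * k + 1) * (1 - y) ^ 4 := by
    rw [intervalIntegral.integral_of_le zero_le_one, ← integral_indicator measurableSet_Ioi,
      ← integral_indicator measurableSet_Ioc]
    refine integral_congr_ae (Eventually.of_forall fun y => ?_)
    simp only [indicator_apply, mem_Ioi, mem_Ioc, smul_eq_mul]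
    by_cases h0 : 0 < y <;> by_cases h1 : y ≤ 1
    · rw [if_pos h0, if_pos ⟨h0, h1⟩, max_eq_left (by linarith)]
      ring
    · rw [if_pos h0, if_neg (fun h => h1 h.2), max_eq_right (by linarith)]
      ring
    · rw [if_neg h0, if_neg (fun h => h0 h.1)]
    · rw [if_neg h0, if_neg (fun h => h0 h.1)]
  rw [hI, hb, intervalIntegral_pow_mul_one_sub_pow_four, ← choose_five_mul, discMoment]
  have hc : ((2 * k + 1 + 5).choose 5 : ℝ) ≠ 0 := by
    exact_mod_cast (Nat.choose_pos (by omega : 5 ≤ 2 * k + 1 + 5)).ne'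
  simp only [smul_eq_mul, nsmul_eq_mul]
  field_simp
  norm_num

section

variable {n : ℕ} {Ω : Set (Fin (n + 1) → ℂ)}

/-- Fubini for the moments of a domain along the first coordinate. -/
theorem setIntegral_norm_pow_eq (hΩ : MeasurableSet Ω) (hfin : volume Ω ≠ ⊤)
    (hlt : ∀ w ∈ Ω, ‖w 0‖ < 1) (j : ℕ) :
    ∫ w in Ω, ‖w 0‖ ^ j = ∫ z : ℂ, ‖z‖ ^ j *
      volume.real {v : Fin n → ℂ | (Fin.cons z v : Fin (n + 1) → ℂ) ∈ Ω} := by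
  have hmp := (volume_preserving_piFinSuccAbove (fun _ : Fin (n + 1) => ℂ) 0).symm
  set e := (MeasurableEquiv.piFinSuccAbove (fun _ : Fin (n + 1) => ℂ) 0).symm with he
  have hcons : ∀ p : ℂ × (Fin n → ℂ), e p = (Fin.cons p.1 p.2 : Fin (n + 1) → ℂ) := fun p => by
    rw [he, MeasurableEquiv.piFinSuccAbove_symm_apply, Fin.insertNthEquiv_zero]
    rfl
  have hS : MeasurableSet (e ⁻¹' Ω) := e.measurable hΩ
  have hSfin : volume (e ⁻¹' Ω) ≠ ⊤ := by
    rwa [hmp.measure_preimage hΩ.nullMeasurableSet]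
  have : IsFiniteMeasure (volume.restrict (e ⁻¹' Ω)) := ⟨by simpa using hSfin.lt_top⟩
  rw [← hmp.setIntegral_preimage_emb e.measurableEmbedding]
  have h0 : ∀ p : ℂ × (Fin n → ℂ), e p 0 = p.1 := fun p => by rw [hcons]; rfl
  simp only [h0]
  have hint : IntegrableOn (fun p : ℂ × (Fin n → ℂ) => ‖p.1‖ ^ j) (e ⁻¹' Ω) := by
    refine Integrable.of_bound (Continuous.aestronglyMeasurable (by fun_prop)) 1 ?_
    filter_upwards [ae_restrict_mem hS] with p hp
    have := hlt _ hp
    rw [h0] at this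
    rw [norm_pow, norm_norm]
    exact pow_le_one₀ (norm_nonneg _) this.le
  rw [← integral_indicator hS]
  rw [← integrable_indicator_iff hS] at hint
  rw [Measure.volume_eq_prod] at hint ⊢
  rw [integral_prod _ hint]
  refine integral_congr_ae (Eventually.of_forall fun z => ?_)
  have hmem : ∀ v : Fin n → ℂ, (z, v) ∈ e ⁻¹' Ω ↔ (Fin.cons z v : Fin (n + 1) → ℂ) ∈ Ω := by
    intro v
    rw [mem_preimage, hcons]
  have hfib : MeasurableSet {v : Fin n → ℂ | (Fin.cons z v : Fin (n + 1) → ℂ) ∈ Ω} := by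
    simp only [← hmem]
    exact measurable_prodMk_left hS
  have hi : ∀ v : Fin n → ℂ, (e ⁻¹' Ω).indicator (fun p : ℂ × (Fin n → ℂ) => ‖p.1‖ ^ j) (z, v) =
      {v : Fin n → ℂ | (Fin.cons z v : Fin (n + 1) → ℂ) ∈ Ω}.indicator (fun _ => ‖z‖ ^ j) v := by
    intro v
    classical
    simp only [indicator_apply, hmem, mem_ofPred_eq]
  simp only [hi]
  rw [integral_indicator_const _ hfib, smul_eq_mul, mul_comm]

/-- The common shape of the kernels of the two domains along the first coordinate axis. -/
noncomputable def axisKernel (t : ℂ) : ℂ := ∑' k, t ^ k / discMoment k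

theorem summable_pow_div_discMoment {r : ℝ} (h0 : 0 ≤ r) (h1 : r < 1) :
    Summable fun k => r ^ k / discMoment k := by
  set s : ℝ := (1 + r) / 2 with hs
  have hs0 : 0 < s := by positivity
  have hs1 : s < 1 := by rw [hs]; linarith
  -- By AM-GM. Hence `r ^ k ≤ s ^ (2 * k)`, and the series is dominated by the odd-indexed part of a
  -- convergent binomial series in `s`.
  have hrs : r ≤ s ^ 2 := by rw [hs]; nlinarith [sq_nonneg (1 - r)]
  have hsum := (summable_choose_mul_geometric_of_norm_lt_one 5 (r := s)
    (by rwa [Real.norm_of_nonneg hs0.le])).comp_injective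
    (i := fun k : ℕ => 2 * k + 1) fun a b h => by simpa using h
  refine Summable.of_nonneg_of_le (fun k => div_nonneg (by positivity) (discMoment_pos k).le)
    (fun k => ?_) (hsum.mul_left (5 / (2 * Real.pi * s)))
  have hle : r ^ k ≤ s ^ (2 * k) := by rw [pow_mul]; exact pow_le_pow_left₀ h0 hrs k
  calc r ^ k / discMoment k ≤ s ^ (2 * k) / discMoment k := by
        have := (discMoment_pos k).le
        gcongr
    _ = _ := by
        have hc : ((2 * k + 1 + 5).choose 5 : ℝ) ≠ 0 := by
          exact_mod_cast (Nat.choose_pos (by omega : 5 ≤ 2 * k + 1 + 5)).ne'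
        simp only [discMoment, Function.comp_apply]
        field_simp
        rw [pow_succ]

theorem IsCompleteReinhardt.bergmanKernel_single_eq_axisKernel (hR : IsCompleteReinhardt Ω)
    (hΩ : IsOpen Ω) (hdisc : ∀ ζ : ℂ, Pi.single 0 ζ ∈ Ω ↔ ‖ζ‖ < 1) (hfin : volume Ω ≠ ⊤) {c : ℝ}
    (hc : 0 < c)
    (hfib : ∀ z : ℂ, volume.real {v : Fin n → ℂ | (Fin.cons z v : Fin (n + 1) → ℂ) ∈ Ω} =
      max (1 - ‖z‖) 0 ^ 4 * c) {z w : ℂ} (hz : ‖z‖ < 1) (hw : ‖w‖ < 1) :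
    bergmanKernel Ω (Pi.single 0 z) (Pi.single 0 w) = (c : ℂ)⁻¹ * axisKernel (z * conj w) := by
  have hm : ∀ k, ∫ w in Ω, ‖w 0‖ ^ (2 * k) = discMoment k * c := fun k => by
    rw [setIntegral_norm_pow_eq hΩ.measurableSet hfin fun w hw => hR.norm_lt_one hdisc hw]
    simp only [hfib, ← mul_assoc]
    rw [integral_mul_const, integral_norm_pow_mul_max_pow_four]
  rw [hR.bergmanKernel_single hΩ hfin hdisc hm (fun k => mul_pos (discMoment_pos k) hc)
    (fun r h0 h1 => ?_) hz hw, axisKernel, ← tsum_mul_left]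
  · refine tsum_congr fun k => ?_
    push_cast
    rw [← div_div, div_eq_inv_mul _ (c : ℂ)]
  · simpa only [div_div] using (summable_pow_div_discMoment h0 h1).div_const c

end

/-! ### Closed form and zeroes of the axis series. -/

theorem axisKernel_zero_ne : axisKernel 0 ≠ 0 := by
  rw [axisKernel, tsum_eq_single 0 fun k hk => by simp [hk]]
  simpa using (discMoment_pos 0).ne'

/-- The closed form of the kernel. -/
theorem mul_axisKernel_sq {x : ℂ} (hx : ‖x‖ < 1) :
    x * axisKernel (x ^ 2) = 5 / (4 * Real.pi) * (1 / (1 - x) ^ 6 - 1 / (1 + x) ^ 6) := by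
  have h1 := hasSum_choose_mul_geometric_of_norm_lt_one 5 hx
  have h2 := hasSum_choose_mul_geometric_of_norm_lt_one 5 (r := -x) (by simpa using hx)
  have h3 := h1.sub h2
  rw [sub_neg_eq_add] at h3
  -- Even powers cancel in the difference of the two series, so summing over odd indices suffices.
  have hinj : Function.Injective fun k : ℕ => 2 * k + 1 := fun a b h => by simpa using h
  rw [← hinj.hasSum_iff] at h3
  · rw [← h3.tsum_eq, axisKernel, ← tsum_mul_left, ← tsum_mul_left]
    refine tsum_congr fun k => ?_
    have hpi : (Real.pi : ℂ) ≠ 0 := by simp [Real.pi_ne_zero]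
    have hodd : (-x) ^ (2 * k + 1) = -x ^ (2 * k + 1) := Odd.neg_pow ⟨k, rfl⟩ x
    simp only [Function.comp_apply, discMoment, hodd]
    push_cast
    field_simp
    ring
  · intro m hm
    have he : Even m := by
      by_contra h
      obtain ⟨k, hk⟩ := Nat.not_even_iff_odd.1 h
      exact hm ⟨k, hk.symm⟩
    rw [he.neg_pow, sub_self]

/-- The condition `x ≠ 0` cannot be dropped: `x = 0` solves the equation, but the constant term of
the series is nonzero. -/
theorem axisKernel_sq_eq_zero_iff {x : ℂ} (hx : ‖x‖ < 1) :
    axisKernel (x ^ 2) = 0 ↔ x ≠ 0 ∧ ((1 + x) / (1 - x)) ^ 6 = 1 := by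
  by_cases h0 : x = 0
  · subst h0
    simpa using axisKernel_zero_ne
  have hm : 1 - x ≠ 0 := fun h => by
    rw [← sub_eq_zero.1 h] at hx; simp at hx
  have hp : 1 + x ≠ 0 := fun h => by
    rw [eq_neg_of_add_eq_zero_right h] at hx; simp at hx
  have hpi : (5 / (4 * Real.pi) : ℂ) ≠ 0 := by simp [Real.pi_ne_zero]
  have key := mul_axisKernel_sq hx
  have h1 : axisKernel (x ^ 2) = 0 ↔ 1 / (1 - x) ^ 6 - 1 / (1 + x) ^ 6 = 0 := by
    constructor <;> intro h <;> rw [h, mul_zero] at key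
    · exact (mul_eq_zero.1 key.symm).resolve_left hpi
    · exact (mul_eq_zero.1 key).resolve_left h0
  rw [h1, div_pow, div_eq_one_iff_eq (pow_ne_zero 6 hm), sub_eq_zero,
    div_eq_div_iff (pow_ne_zero 6 hm) (pow_ne_zero 6 hp), one_mul, one_mul]
  exact ⟨fun h => ⟨h0, h⟩, fun h => h.2⟩

/-- For `x = i tan (π / 6) = i / √3` the quotient is `exp (i π / 3)`, a sixth root of unity. -/
theorem exists_div_pow_six_eq_one :
    ∃ x : ℂ, x ^ 2 = -(1 / 3 : ℝ) ∧ ‖x‖ < 1 ∧ x ≠ 0 ∧ ((1 + x) / (1 - x)) ^ 6 = 1 := by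
  have hsq : (√(1 / 3) : ℝ) ^ 2 = 1 / 3 := Real.sq_sqrt (by norm_num)
  have hpos : 0 < √(1 / 3 : ℝ) := Real.sqrt_pos.2 (by norm_num)
  set x : ℂ := (√(1 / 3) : ℝ) * Complex.I with hx
  have hx2 : x ^ 2 = -(1 / 3 : ℝ) := by
    rw [hx, mul_pow, Complex.I_sq, ← Complex.ofReal_pow, hsq, mul_neg_one]
  have hnorm : ‖x‖ < 1 := by
    rw [hx, norm_mul, Complex.norm_I, mul_one, Complex.norm_real, Real.norm_of_nonneg hpos.le]
    nlinarith
  have hm : 1 - x ≠ 0 := fun h => by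
    rw [← sub_eq_zero.1 h] at hnorm; simp at hnorm
  refine ⟨x, hx2, hnorm, mul_ne_zero (by exact_mod_cast hpos.ne') Complex.I_ne_zero, ?_⟩
  rw [div_pow, div_eq_one_iff_eq (pow_ne_zero 6 hm)]
  push_cast at hx2
  -- `(1 + x)⁶ - (1 - x)⁶ = 12 x (x² + 3) (x² + 1/3)`.
  linear_combination 12 * x * (x ^ 2 + 3) * hx2

/-! ### The two domains and their fibres. -/

theorem single_eq_vecCons_three (z : ℂ) : (Pi.single 0 z : Fin 3 → ℂ) = ![z, 0, 0] := by
  ext i; fin_cases i <;> simp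

theorem single_eq_vecCons_two (z : ℂ) : (Pi.single 0 z : Fin 2 → ℂ) = ![z, 0] := by
  ext i; fin_cases i <;> simp

theorem volume_ne_top_of_norm_lt_one {n : ℕ} {Ω : Set (Fin n → ℂ)}
    (h : ∀ w ∈ Ω, ∀ i, ‖w i‖ < 1) : volume Ω ≠ ⊤ :=
  ne_top_of_le_ne_top (measure_closedBall_lt_top (x := (0 : Fin n → ℂ)) (r := 1)).ne <|
    measure_mono fun w hw => by
      rw [mem_closedBall_zero_iff]
      exact (pi_norm_le_iff_of_nonneg zero_le_one).2 fun i => (h w hw i).le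

theorem isOpen_domainD : IsOpen domainD :=
  isOpen_lt (by fun_prop) continuous_const

theorem convex_domainD : Convex ℝ domainD := by
  have h : ∀ i : Fin 3, ConvexOn ℝ univ fun z : Fin 3 → ℂ => ‖z i‖ := fun i =>
    (convexOn_univ_norm (E := ℂ)).comp_linearMap (LinearMap.proj i : (Fin 3 → ℂ) →ₗ[ℝ] ℂ)
  simpa [domainD] using (((h 0).add (h 1)).add (h 2)).convex_lt 1

theorem isCompleteReinhardt_domainD : IsCompleteReinhardt domainD := fun w hw v hv => by
  simp only [domainD, mem_ofPred_eq] at hw ⊢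
  linarith [hv 0, hv 1, hv 2]

theorem single_mem_domainD (ζ : ℂ) : (Pi.single 0 ζ : Fin 3 → ℂ) ∈ domainD ↔ ‖ζ‖ < 1 := by
  simp [domainD]

theorem volume_domainD_ne_top : volume domainD ≠ ⊤ :=
  volume_ne_top_of_norm_lt_one fun w hw i => by
    simp only [domainD, mem_ofPred_eq] at hw
    have h0 := norm_nonneg (w 0)
    have h1 := norm_nonneg (w 1)
    have h2 := norm_nonneg (w 2)
    fin_cases i <;> simp <;> linarith

/-- Dirichlet's formula for the ℓ¹ ball of radius `1 - ‖z‖` in ℂ²: the constant is `(π Γ(3))² / Γ(5)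
= π² / 6`. -/
theorem volume_fiber_domainD (z : ℂ) :
    volume.real {v : Fin 2 → ℂ | (Fin.cons z v : Fin 3 → ℂ) ∈ domainD} =
      max (1 - ‖z‖) 0 ^ 4 * (Real.pi ^ 2 / 6) := by
  have hset : {v : Fin 2 → ℂ | (Fin.cons z v : Fin 3 → ℂ) ∈ domainD} =
      {v : Fin 2 → ℂ | (∑ i, ‖v i‖ ^ (1 : ℝ)) ^ (1 / (1 : ℝ)) < 1 - ‖z‖} := by
    ext v
    change ‖z‖ + ‖v 0‖ + ‖v 1‖ < 1 ↔ _
    simp only [mem_ofPred_eq, Real.rpow_one, div_one, Fin.sum_univ_two]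
    constructor <;> intro h <;> linarith
  rw [hset, measureReal_def, Complex.volume_sum_rpow_lt (Fin 2) le_rfl]
  have h3 : Real.Gamma (2 / 1 + 1) = 2 := by
    have := Real.Gamma_nat_eq_factorial 2
    norm_num at this ⊢
  have h5 : Real.Gamma (2 * (Fintype.card (Fin 2) : ℝ) / 1 + 1) = 24 := by
    have := Real.Gamma_nat_eq_factorial 4
    norm_num [Nat.factorial] at this ⊢
  rw [h3, h5, ENNReal.toReal_mul, ENNReal.toReal_pow, ENNReal.toReal_ofReal',
    ENNReal.toReal_ofReal (by positivity), Fintype.card_fin]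
  ring

theorem isOpen_domainOmega_four : IsOpen (domainOmega 4) :=
  isOpen_lt (Continuous.add (by fun_prop) (Continuous.rpow_const (by fun_prop)
    fun _ => Or.inr (by norm_num))) continuous_const

theorem isCompleteReinhardt_domainOmega_four : IsCompleteReinhardt (domainOmega 4) :=
  fun w hw v hv => by
    simp only [domainOmega, mem_ofPred_eq] at hw ⊢
    have := Real.rpow_le_rpow (norm_nonneg _) (hv 1) (by norm_num : (0 : ℝ) ≤ 2 / 4)
    linarith [hv 0]

theorem single_mem_domainOmega_four (ζ : ℂ) :
    (Pi.single 0 ζ : Fin 2 → ℂ) ∈ domainOmega 4 ↔ ‖ζ‖ < 1 := by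
  simp only [domainOmega, mem_ofPred_eq, Pi.single_eq_same]
  rw [Pi.single_eq_of_ne one_ne_zero, norm_zero, Real.zero_rpow (by norm_num), add_zero]

theorem volume_domainOmega_four_ne_top : volume (domainOmega 4) ≠ ⊤ :=
  volume_ne_top_of_norm_lt_one fun w hw i => by
    simp only [domainOmega, mem_ofPred_eq] at hw
    have h0 := norm_nonneg (w 0)
    have h1 := Real.rpow_nonneg (norm_nonneg (w 1)) (2 / 4)
    fin_cases i
    · simp only [Fin.zero_eta]
      linarith
    · by_contra h
      have := Real.one_le_rpow (not_lt.1 h) (by norm_num : (0 : ℝ) ≤ 2 / 4)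
      simp only [Fin.mk_one] at this
      linarith

/-- The fibre is a disc of radius `(1 - ‖z‖)²`; for `‖z‖ ≥ 1` the truncated radius is `0` and the
open ball is empty. -/
theorem volume_fiber_domainOmega_four (z : ℂ) :
    volume.real {v : Fin 1 → ℂ | (Fin.cons z v : Fin 2 → ℂ) ∈ domainOmega 4} =
      max (1 - ‖z‖) 0 ^ 4 * Real.pi := by
  have hset : {v : Fin 1 → ℂ | (Fin.cons z v : Fin 2 → ℂ) ∈ domainOmega 4} =
      Set.pi univ fun _ : Fin 1 => ball (0 : ℂ) (max (1 - ‖z‖) 0 ^ 2) := by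
    ext v
    change ‖z‖ + ‖v 0‖ ^ (2 / 4 : ℝ) < 1 ↔ _
    have e : (2 / 4 : ℝ) = 1 / 2 := by norm_num
    rw [e, ← Real.sqrt_eq_rpow]
    have hs := Real.sqrt_nonneg ‖v 0‖
    simp only [Set.mem_pi, mem_univ, true_implies, Fin.forall_fin_one, mem_ball_zero_iff]
    rcases lt_or_ge ‖z‖ 1 with h | h
    · rw [max_eq_left (by linarith), ← Real.sqrt_lt' (by linarith)]
      constructor <;> intro h <;> linarith
    · rw [max_eq_right (by linarith)]
      have := norm_nonneg (v 0)
      constructor <;> intro h <;> norm_num at h <;> linarith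
  rw [hset, measureReal_def, volume_pi_pi]
  simp only [Complex.volume_ball, Finset.univ_unique, Finset.prod_const, Finset.card_singleton,
    pow_one, ENNReal.toReal_mul, ENNReal.toReal_pow, ENNReal.coe_toReal, NNReal.coe_real_pi]
  rw [ENNReal.toReal_ofReal (by positivity)]
  ring

theorem bergmanKernel_domainD_single {z w : ℂ} (hz : ‖z‖ < 1) (hw : ‖w‖ < 1) :
    bergmanKernel domainD ![z, 0, 0] ![w, 0, 0] =
      ((Real.pi ^ 2 / 6 : ℝ) : ℂ)⁻¹ * axisKernel (z * conj w) := by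
  rw [← single_eq_vecCons_three, ← single_eq_vecCons_three]
  exact isCompleteReinhardt_domainD.bergmanKernel_single_eq_axisKernel isOpen_domainD
    single_mem_domainD volume_domainD_ne_top (by positivity) volume_fiber_domainD hz hw

theorem bergmanKernel_domainOmega_four_single {z w : ℂ} (hz : ‖z‖ < 1) (hw : ‖w‖ < 1) :
    bergmanKernel (domainOmega 4) ![z, 0] ![w, 0] =
      (Real.pi : ℂ)⁻¹ * axisKernel (z * conj w) := by
  rw [← single_eq_vecCons_two, ← single_eq_vecCons_two]
  exact isCompleteReinhardt_domainOmega_four.bergmanKernel_single_eq_axisKernel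
    isOpen_domainOmega_four single_mem_domainOmega_four volume_domainOmega_four_ne_top
    Real.pi_pos volume_fiber_domainOmega_four hz hw

theorem mainTheorem4 :
    -- the domains, and the existence of their Bergman kernels
    (IsOpen domainD ∧ Convex ℝ domainD ∧ IsOpen (domainOmega 4)) ∧
    IsBergmanKernel domainD (bergmanKernel domainD) ∧
    IsBergmanKernel (domainOmega 4) (bergmanKernel (domainOmega 4)) ∧
    -- the Bergman kernel of the convex domain has zeroes
    (∃ z ∈ domainD, ∃ w ∈ domainD, bergmanKernel domainD z w = 0) ∧
    -- deflation
    (∀ z₁ w₁ : ℂ, ‖z₁‖ < 1 → ‖w₁‖ < 1 →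
      bergmanKernel domainD ![z₁, 0, 0] ![w₁, 0, 0] =
        ((6 / Real.pi : ℝ) : ℂ) * bergmanKernel (domainOmega 4) ![z₁, 0] ![w₁, 0]) ∧
    -- the zeroes of the kernel of the domain in dimension two
    (∀ z₁ w₁ : ℂ, ‖z₁‖ < 1 → ‖w₁‖ < 1 →
      (bergmanKernel (domainOmega 4) ![z₁ ^ 2, 0] ![w₁ ^ 2, 0] = 0 ↔
        z₁ * conj w₁ ≠ 0 ∧ ((1 + z₁ * conj w₁) / (1 - z₁ * conj w₁)) ^ 6 = 1)) ∧
    (∃ x : ℂ, ‖x‖ < 1 ∧ x ≠ 0 ∧ ((1 + x) / (1 - x)) ^ 6 = 1) := by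
  have hpi : (Real.pi : ℂ) ≠ 0 := by simp [Real.pi_ne_zero]
  obtain ⟨x, hx2, hx1, hx0, hx6⟩ := exists_div_pow_six_eq_one
  refine ⟨⟨isOpen_domainD, convex_domainD, isOpen_domainOmega_four⟩,
    isBergmanKernel_bergmanKernel isOpen_domainD,
    isBergmanKernel_bergmanKernel isOpen_domainOmega_four, ?_, ?_, ?_, x, hx1, hx0, hx6⟩
  -- Any two points of the disc with `z * conj w = -1/3 = x ^ 2` would do.
  · have hz : ‖(-(2 / 3) : ℂ)‖ < 1 := by norm_num
    have hw : ‖(1 / 2 : ℂ)‖ < 1 := by norm_num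
    refine ⟨![-(2 / 3), 0, 0], ?_, ![1 / 2, 0, 0], ?_, ?_⟩
    · rw [← single_eq_vecCons_three]
      exact (single_mem_domainD _).2 hz
    · rw [← single_eq_vecCons_three]
      exact (single_mem_domainD _).2 hw
    · have hzw : (-(2 / 3) : ℂ) * conj (1 / 2 : ℂ) = x ^ 2 := by
        have h : ((1 / 2 : ℝ) : ℂ) = 1 / 2 := by push_cast; rfl
        rw [hx2, ← h, Complex.conj_ofReal]
        push_cast
        norm_num
      rw [bergmanKernel_domainD_single hz hw, hzw,
        (axisKernel_sq_eq_zero_iff hx1).2 ⟨hx0, hx6⟩, mul_zero]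
  · intro z w hz hw
    rw [bergmanKernel_domainD_single hz hw, bergmanKernel_domainOmega_four_single hz hw]
    push_cast
    field_simp
  · intro z w hz hw
    have hsq : ∀ {u : ℂ}, ‖u‖ < 1 → ‖u ^ 2‖ < 1 := fun h => by
      rw [norm_pow]
      exact pow_lt_one₀ (norm_nonneg _) h two_ne_zero
    have hzw : ‖z * conj w‖ < 1 := by
      rw [norm_mul, RCLike.norm_conj]
      exact mul_lt_one_of_nonneg_of_lt_one_left (norm_nonneg _) hz hw.le
    rw [bergmanKernel_domainOmega_four_single (hsq hz) (hsq hw), map_pow, ← mul_pow,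
      mul_eq_zero, or_iff_right (inv_ne_zero hpi), axisKernel_sq_eq_zero_iff hzw]
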